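/- For a finite group $G$, the enhanced power graph $\mathcal G_E(G)$ has vertex set $G$, two distinct elements $u,v$ being adjacent if and only if $u,v\in\langle w\rangle$ for some $w\in G$. The proper enhanced power graph $\mathcal G_E^{**}(G)$ is obtained from it by deleting all dominating vertices, i.e. all vertices adjacent to every other vertex. The domination number $\gamma(\Gamma)$ of a graph $\Gamma$ is the least cardinality of a set $D$ of vertices such that every vertex outside $D$ is adjacent to some vertex of $D$. For $k\ge 3$ let $Q_{2^k}=\langle x,y\mid x^{2^{k-1}}=1,\ y^2=x^{2^{k-2}},\ yxy^{-1}=x^{-1}\rangle$ be the generalized quaternion group of order $2^k$. Theorem. Let $G$ be a finite nilpotent group having a generalized quaternion Sylow subgroup, isomorphic to $Q_{2^k}$, $k\ge 3$. Then $G$ is, up to isomorphism, of one of the forms listed below, and $$\gamma(\mathcal G_E^{**}(G))=\begin{cases}2^{k-2}+1, & \text{if } G\cong Q_{2^k},\ \text{or } G\cong\mathbb Z_n\times Q_{2^k} \text{ with } \gcd(n,2)=1,\\[2pt] \min\{r_1,\,2^{k-2}+1\}, & \text{if } G\cong G_1\times Q_{2^k} \text{ with } \gcd(|G_1|,2)=1,\\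 & \text{or } G\cong G_1\times\mathbb Z_n\times Q_{2^k} \text{ with } \gcd(|G_1|,n)=\gcd(|G_1|,2)=\gcd(n,2)=1.\end{cases}$$ Here $n\ge 1$, $G_1$ denotes a nontrivial finite nilpotent group such that for no prime $p$ dividing $|G_1|$ the Sylow $p$-subgroup of $G_1$ is cyclic or generalized quaternion, and $r_1$ is the minimum, over the primes $p$ dividing $|G_1|$, of the number of subgroups of order $p$ in the Sylow $p$-subgroup of $G_1$. -/

import Mathlib

/-- The enhanced power graph of a group: distinct `u`, `v` are adjacent iff both lie in one
cyclic subgroup `⟨w⟩`. -/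
def enhancedPowerGraph (G : Type*) [Group G] : SimpleGraph G where
  Adj u v := u ≠ v ∧ ∃ w : G, u ∈ Subgroup.zpowers w ∧ v ∈ Subgroup.zpowers w
  symm := ⟨fun _ _ h => ⟨h.1.symm, h.2.imp fun _ hw => ⟨hw.2, hw.1⟩⟩⟩
  loopless := ⟨fun _ h => h.1 rfl⟩

/-- The vertices that are adjacent to every other vertex. -/
def dominatingVertices {V : Type*} (Γ : SimpleGraph V) : Set V :=
  {v | ∀ u, u ≠ v → Γ.Adj v u}

/-- The enhanced power graph with all its dominating vertices deleted. -/
def properEnhancedPowerGraph (G : Type*) [Group G] :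
    SimpleGraph ((dominatingVertices (enhancedPowerGraph G))ᶜ : Set G) :=
  (enhancedPowerGraph G).induce (dominatingVertices (enhancedPowerGraph G))ᶜ

/-- `D` is a dominating set: every vertex outside `D` is adjacent to some vertex of `D`. -/
def IsDominatingSet {V : Type*} (Γ : SimpleGraph V) (D : Set V) : Prop :=
  ∀ v, v ∉ D → ∃ u ∈ D, Γ.Adj v u

/-- The least cardinality of a dominating set. -/
noncomputable def dominationNumber {V : Type*} (Γ : SimpleGraph V) : ℕ∞ :=
  ⨅ (D : Set V) (_ : IsDominatingSet Γ D), D.encard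

/-- The generalized quaternion group of order `2 ^ k` (meaningful for `3 ≤ k`); Mathlib's
`QuaternionGroup m` has order `4 * m`. -/
abbrev GenQuaternion (k : ℕ) : Type := QuaternionGroup (2 ^ (k - 2))

/-- `H` is isomorphic to a generalized quaternion group of order `2 ^ k` with `k ≥ 3`. -/
def IsGenQuaternion (H : Type*) [Group H] : Prop :=
  ∃ k : ℕ, 3 ≤ k ∧ Nonempty (H ≃* GenQuaternion k)

/-- Nontrivial finite nilpotent groups none of whose (nontrivial) Sylow subgroups is cyclic or
generalized quaternion. -/
structure IsNilpotentWithoutCyclicOrQuaternionSylow (H : Type*) [Group H] : Prop where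
  finite : Finite H
  nontrivial : Nontrivial H
  nilpotent : Group.IsNilpotent H
  sylow : ∀ p : ℕ, p.Prime → p ∣ Nat.card H → ∀ P : Sylow p H,
    ¬ IsCyclic P ∧ ¬ IsGenQuaternion P

/-- The minimum, over the primes `p` dividing the order of `H`, of the number of subgroups of
order `p` in a Sylow `p`-subgroup of `H`. -/
noncomputable def minNumPrimeOrderSubgroups (H : Type*) [Group H] : ℕ :=
  sInf {r : ℕ | ∃ p : ℕ, p.Prime ∧ p ∣ Nat.card H ∧ ∃ P : Sylow p H,
    r = Nat.card {K : Subgroup P // Nat.card K = p}}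

/-!
Call two elements related when they lie in a common cyclic subgroup. The dominating vertices of the
enhanced power graph form the set of elements related to everything (the cyclicizer), and a
dominating set of the proper graph is a set avoiding the cyclicizer such that every element outside
the cyclicizer is related to one of its members.

In a direct product of groups of coprime orders, two elements are related iff all their components
are, and the cyclicizer is the product of the cyclicizers. A cyclic factor is its own cyclicizer and
changes nothing. For noncyclic factors the domination number is the minimum of those of the factors:
a dominating set of one factor dominates the product, whereas if `D` is smaller than the domination
number of each factor, then every projection of `D` fails to dominate, and the vertex whose
components witness these failures is related to no `d ∈ D` outside the cyclicizer.

A finite nilpotent group is the product of its Sylow subgroups, so two cases remain. In the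
quaternion group of order `4 m` every noncentral element lies in exactly one of the `m + 1` maximal
cyclic subgroups. In a `p`-group with at least two subgroups of order `p`, every nontrivial element
is related to the generators of exactly one of these subgroups, so `γ` is their number. For odd `p`,
a minimal counterexample to "one subgroup of order `p` implies cyclic" has abelian maximal
subgroups, hence a central Frattini subgroup containing all commutators and all `p`-th powers. Then
`x ↦ x ^ p` is an endomorphism with image in the Frattini subgroup and kernel of order `p`, so the
Frattini subgroup is maximal and the group is cyclic after all.
-/

/-- `u` and `v` lie in a common cyclic subgroup: the reflexive closure of adjacency in the enhanced
power graph. -/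
def CyclicallyRelated {G : Type*} [Group G] (u v : G) : Prop :=
  ∃ w : G, u ∈ Subgroup.zpowers w ∧ v ∈ Subgroup.zpowers w

/-- The elements that lie in a common cyclic subgroup with every element of the group. They are the
dominating vertices of the enhanced power graph. -/
def cyclicizer (G : Type*) [Group G] : Set G :=
  {v | ∀ u, CyclicallyRelated v u}

/-- A dominating set of the proper enhanced power graph, encoded as a set of elements of the whole
group that avoids the cyclicizer. -/
structure IsProperDominatingSet {G : Type*} [Group G] (D : Set G) : Prop where
  notMem_cyclicizer : ∀ d ∈ D, d ∉ cyclicizer G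
  exists_related : ∀ v ∉ cyclicizer G, ∃ d ∈ D, CyclicallyRelated v d

namespace CyclicallyRelated

variable {G H : Type*} [Group G] [Group H] {u v : G}

theorem of_mem_zpowers (h : u ∈ Subgroup.zpowers v) : CyclicallyRelated u v :=
  ⟨v, h, Subgroup.mem_zpowers v⟩

theorem refl (u : G) : CyclicallyRelated u u :=
  of_mem_zpowers (Subgroup.mem_zpowers u)

theorem symm (h : CyclicallyRelated u v) : CyclicallyRelated v u :=
  h.imp fun _ hw => hw.symm

theorem one_right (u : G) : CyclicallyRelated u 1 :=
  ⟨u, Subgroup.mem_zpowers u, one_mem _⟩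

theorem of_isCyclic [IsCyclic G] (u v : G) : CyclicallyRelated u v :=
  let ⟨w, hw⟩ := IsCyclic.exists_generator (α := G)
  ⟨w, hw u, hw v⟩

theorem map (f : G →* H) (h : CyclicallyRelated u v) : CyclicallyRelated (f u) (f v) := by
  obtain ⟨w, ⟨m, rfl⟩, ⟨n, rfl⟩⟩ := h
  exact ⟨f w, ⟨m, (map_zpow f w m).symm⟩, ⟨n, (map_zpow f w n).symm⟩⟩

end CyclicallyRelated

section Cyclicizer

variable {G H : Type*} [Group G] [Group H]

theorem dominatingVertices_enhancedPowerGraph :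
    dominatingVertices (enhancedPowerGraph G) = cyclicizer G := by
  ext v
  refine ⟨fun h u => ?_, fun h u huv => ⟨huv.symm, h u⟩⟩
  obtain rfl | huv := eq_or_ne u v
  · exact .refl u
  · exact (h u huv).2

theorem mem_cyclicizer_of_isCyclic [IsCyclic G] (v : G) : v ∈ cyclicizer G :=
  CyclicallyRelated.of_isCyclic v

theorem map_mem_cyclicizer {f : G →* H} (hf : Function.Surjective f) {v : G}
    (hv : v ∈ cyclicizer G) : f v ∈ cyclicizer H :=
  hf.forall.2 fun u => (hv u).map f

theorem map_mulEquiv_mem_cyclicizer_iff (e : G ≃* H) {v : G} :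
    e v ∈ cyclicizer H ↔ v ∈ cyclicizer G :=
  ⟨fun h => by simpa using map_mem_cyclicizer (f := e.symm.toMonoidHom) e.symm.surjective h,
    map_mem_cyclicizer (f := e.toMonoidHom) e.surjective⟩

theorem isCyclic_of_forall_mem_cyclicizer [Finite G] (h : ∀ v, v ∈ cyclicizer G) :
    IsCyclic G := by
  obtain ⟨w, hw⟩ := Finite.exists_max (orderOf : G → ℕ)
  refine ⟨w, fun g => ?_⟩
  obtain ⟨z, hwz, hgz⟩ := h w g
  have zpowers_eq : Subgroup.zpowers w = Subgroup.zpowers z :=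
    Subgroup.eq_of_le_of_card_ge (Subgroup.zpowers_le.2 hwz) (by simpa using hw z)
  exact (zpowers_eq ▸ hgz : g ∈ Subgroup.zpowers w)

theorem exists_notMem_cyclicizer_forall_imp [Finite G] (hG : ¬ IsCyclic G) (x : G) :
    ∃ y ∉ cyclicizer G, ∀ d, CyclicallyRelated y d → CyclicallyRelated x d := by
  by_cases hx : x ∈ cyclicizer G
  · obtain ⟨y, hy⟩ := not_forall.1 (mt isCyclic_of_forall_mem_cyclicizer hG)
    exact ⟨y, hy, fun d _ => hx d⟩
  · exact ⟨x, hx, fun _ => id⟩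

end Cyclicizer

section CoprimeProducts

theorem pow_eq_pow_of_modEq_natCard {G : Type*} [Group G] {a : G} {m n : ℕ}
    (h : m ≡ n [MOD Nat.card G]) : a ^ m = a ^ n :=
  pow_eq_pow_iff_modEq.2 (h.of_dvd (orderOf_dvd_natCard a))

variable {H K : Type*} [Group H] [Group K] [Finite H] [Finite K]

theorem mem_zpowers_prod_iff (hcop : (Nat.card H).Coprime (Nat.card K)) {u w : H × K} :
    u ∈ Subgroup.zpowers w ↔ u.1 ∈ Subgroup.zpowers w.1 ∧ u.2 ∈ Subgroup.zpowers w.2 := by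
  refine ⟨fun ⟨n, hn⟩ => ⟨⟨n, congr_arg Prod.fst hn⟩, ⟨n, congr_arg Prod.snd hn⟩⟩, ?_⟩
  rintro ⟨h₁, h₂⟩
  obtain ⟨m, hm⟩ := mem_powers_iff_mem_zpowers.2 h₁
  obtain ⟨n, hn⟩ := mem_powers_iff_mem_zpowers.2 h₂
  obtain ⟨l, hlm, hln⟩ := Nat.chineseRemainder hcop m n
  exact ⟨l, Prod.ext (by simpa using (pow_eq_pow_of_modEq_natCard hlm).trans hm)
    (by simpa using (pow_eq_pow_of_modEq_natCard hln).trans hn)⟩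

theorem cyclicallyRelated_prod_iff (hcop : (Nat.card H).Coprime (Nat.card K)) {u v : H × K} :
    CyclicallyRelated u v ↔ CyclicallyRelated u.1 v.1 ∧ CyclicallyRelated u.2 v.2 := by
  refine ⟨fun h => ⟨h.map (.fst H K), h.map (.snd H K)⟩, ?_⟩
  rintro ⟨⟨w₁, hu₁, hv₁⟩, ⟨w₂, hu₂, hv₂⟩⟩
  exact ⟨(w₁, w₂), (mem_zpowers_prod_iff hcop).2 ⟨hu₁, hu₂⟩,
    (mem_zpowers_prod_iff hcop).2 ⟨hv₁, hv₂⟩⟩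

theorem mem_cyclicizer_prod_iff (hcop : (Nat.card H).Coprime (Nat.card K)) {v : H × K} :
    v ∈ cyclicizer (H × K) ↔ v.1 ∈ cyclicizer H ∧ v.2 ∈ cyclicizer K :=
  ⟨fun h => ⟨map_mem_cyclicizer (f := .fst H K) Prod.fst_surjective h,
    map_mem_cyclicizer (f := .snd H K) Prod.snd_surjective h⟩,
    fun h u => (cyclicallyRelated_prod_iff hcop).2 ⟨h.1 u.1, h.2 u.2⟩⟩

variable {ι : Type*} [Finite ι] {P : ι → Type*} [∀ i, Group (P i)] [∀ i, Finite (P i)]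

theorem mem_zpowers_pi_iff (hcop : Pairwise (Function.onFun Nat.Coprime fun i => Nat.card (P i)))
    {u w : ∀ i, P i} : u ∈ Subgroup.zpowers w ↔ ∀ i, u i ∈ Subgroup.zpowers (w i) := by
  refine ⟨fun ⟨n, hn⟩ i => ⟨n, congr_fun hn i⟩, fun h => ?_⟩
  have := Fintype.ofFinite ι
  choose n hn using fun i => mem_powers_iff_mem_zpowers.2 (h i)
  obtain ⟨l, hl⟩ := Nat.chineseRemainderOfFinset n (fun i => Nat.card (P i)) Finset.univ
    (fun i _ => Nat.card_pos.ne') (hcop.set_pairwise _)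
  refine ⟨l, funext fun i => ?_⟩
  simpa using (pow_eq_pow_of_modEq_natCard (hl i (Finset.mem_univ i))).trans (hn i)

theorem cyclicallyRelated_pi_iff
    (hcop : Pairwise (Function.onFun Nat.Coprime fun i => Nat.card (P i))) {u v : ∀ i, P i} :
    CyclicallyRelated u v ↔ ∀ i, CyclicallyRelated (u i) (v i) := by
  refine ⟨fun h i => h.map (Pi.evalMonoidHom P i), fun h => ?_⟩
  choose w hu hv using h
  exact ⟨w, (mem_zpowers_pi_iff hcop).2 hu, (mem_zpowers_pi_iff hcop).2 hv⟩

theorem mem_cyclicizer_pi_iff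
    (hcop : Pairwise (Function.onFun Nat.Coprime fun i => Nat.card (P i))) {v : ∀ i, P i} :
    v ∈ cyclicizer (∀ i, P i) ↔ ∀ i, v i ∈ cyclicizer (P i) :=
  ⟨fun h i => map_mem_cyclicizer (f := Pi.evalMonoidHom P i) (Function.surjective_eval i) h,
    fun h u => (cyclicallyRelated_pi_iff hcop).2 fun i => h i (u i)⟩

theorem isCyclic_pi (hcop : Pairwise (Function.onFun Nat.Coprime fun i => Nat.card (P i)))
    [∀ i, IsCyclic (P i)] : IsCyclic (∀ i, P i) :=
  isCyclic_of_forall_mem_cyclicizer fun v =>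
    (mem_cyclicizer_pi_iff hcop).2 fun i => mem_cyclicizer_of_isCyclic (v i)

end CoprimeProducts

local notation "γ(" G ")" => dominationNumber (properEnhancedPowerGraph G)

section DominationNumber

variable {G H : Type*} [Group G] [Group H]

theorem isDominatingSet_iff_isProperDominatingSet_image
    {D : Set ((dominatingVertices (enhancedPowerGraph G))ᶜ : Set G)} :
    IsDominatingSet (properEnhancedPowerGraph G) D ↔
      IsProperDominatingSet (Subtype.val '' D) := by
  constructor
  · refine fun hD => ⟨?_, fun v hv => ?_⟩
    · rintro _ ⟨d, -, rfl⟩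
      exact dominatingVertices_enhancedPowerGraph (G := G) ▸ d.2
    · rw [← dominatingVertices_enhancedPowerGraph] at hv
      by_cases hvD : ⟨v, hv⟩ ∈ D
      · exact ⟨v, Set.mem_image_of_mem Subtype.val hvD, .refl v⟩
      · obtain ⟨d, hd, hvd⟩ := hD ⟨v, hv⟩ hvD
        exact ⟨d, Set.mem_image_of_mem Subtype.val hd, hvd.2⟩
  · intro hD v hv
    obtain ⟨-, ⟨d, hd, rfl⟩, hvd⟩ :=
      hD.exists_related v (dominatingVertices_enhancedPowerGraph (G := G) ▸ v.2)
    exact ⟨d, hd, fun v_eq_d => hv (Subtype.ext v_eq_d ▸ hd), hvd⟩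

theorem le_dominationNumber_properEnhancedPowerGraph {m : ℕ∞}
    (h : ∀ D : Set G, IsProperDominatingSet D → m ≤ D.encard) : m ≤ γ(G) :=
  le_iInf₂ fun D hD => (h _ (isDominatingSet_iff_isProperDominatingSet_image.1 hD)).trans_eq
    (Subtype.val_injective.encard_image D)

theorem IsProperDominatingSet.dominationNumber_le {D : Set G} (hD : IsProperDominatingSet D) :
    γ(G) ≤ D.encard := by
  have avoids_dominating : ∀ d ∈ D, d ∈ (dominatingVertices (enhancedPowerGraph G))ᶜ :=
    dominatingVertices_enhancedPowerGraph (G := G) ▸ hD.notMem_cyclicizer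
  lift D to Set ((dominatingVertices (enhancedPowerGraph G))ᶜ : Set G) using avoids_dominating
  rw [Subtype.val_injective.encard_image]
  exact iInf₂_le D (isDominatingSet_iff_isProperDominatingSet_image.2 hD)

theorem dominationNumber_le_of_forall_exists (s : H → G)
    (hs : ∀ d ∉ cyclicizer H, s d ∉ cyclicizer G)
    (hv : ∀ v ∉ cyclicizer G, ∃ v' ∉ cyclicizer H,
      ∀ d, CyclicallyRelated v' d → CyclicallyRelated v (s d)) : γ(G) ≤ γ(H) := by
  refine le_dominationNumber_properEnhancedPowerGraph fun D hD => ?_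
  refine le_trans (IsProperDominatingSet.dominationNumber_le ⟨?_, fun v hvG => ?_⟩)
    (Set.encard_image_le s D)
  · exact Set.forall_mem_image.2 fun d hd => hs d (hD.notMem_cyclicizer d hd)
  · obtain ⟨v', hv'H, hv'⟩ := hv v hvG
    obtain ⟨d, hd, hv'd⟩ := hD.exists_related v' hv'H
    exact ⟨s d, Set.mem_image_of_mem s hd, hv' d hv'd⟩

theorem exists_forall_related_imp_mem_cyclicizer {D : Set G} (hD : D.encard < γ(G)) :
    ∃ v ∉ cyclicizer G, ∀ d ∈ D, CyclicallyRelated v d → d ∈ cyclicizer G := by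
  by_contra! h
  refine hD.not_ge (le_trans (IsProperDominatingSet.dominationNumber_le
    ⟨fun d hd => hd.2, fun v hv => ?_⟩) (Set.encard_le_encard (D.sdiff_subset (t := cyclicizer G))))
  obtain ⟨d, hdD, hvd, hd⟩ := h v hv
  exact ⟨d, ⟨hdD, hd⟩, hvd⟩

theorem dominationNumber_eq_card_of_existsUnique {ι : Type*} (g : ι → G)
    (hg : ∀ i, g i ∉ cyclicizer G)
    (h : ∀ d ∉ cyclicizer G, ∃! i, CyclicallyRelated d (g i)) : γ(G) = ENat.card ι := by
  apply le_antisymm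
  · refine le_trans (IsProperDominatingSet.dominationNumber_le (D := Set.range g)
      ⟨Set.forall_mem_range.2 hg, fun d hd => ?_⟩) ?_
    · obtain ⟨i, hi, -⟩ := h d hd
      exact ⟨g i, Set.mem_range_self i, hi⟩
    · rw [← Set.image_univ, ← Set.encard_univ]
      exact Set.encard_image_le g Set.univ
  · refine le_dominationNumber_properEnhancedPowerGraph fun D hD => ?_
    choose f hfD hf using fun i => hD.exists_related (g i) (hg i)
    have f_injective : Function.Injective fun i => (⟨f i, hfD i⟩ : D) := fun i j hij => by
      have hij : f i = f j := congr_arg Subtype.val hij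
      exact (h (f i) (hD.notMem_cyclicizer _ (hfD i))).unique (hf i).symm (hij ▸ (hf j).symm)
    exact ENat.card_le_card_of_injective f_injective

theorem dominationNumber_le_of_mulEquiv (e : G ≃* H) : γ(G) ≤ γ(H) :=
  dominationNumber_le_of_forall_exists e.symm
    (fun _ => mt (map_mulEquiv_mem_cyclicizer_iff e.symm).1)
    fun v hv => ⟨e v, mt (map_mulEquiv_mem_cyclicizer_iff e).1 hv,
      fun d h => by simpa using h.map e.symm.toMonoidHom⟩

theorem dominationNumber_congr (e : G ≃* H) : γ(G) = γ(H) :=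
  le_antisymm (dominationNumber_le_of_mulEquiv e) (dominationNumber_le_of_mulEquiv e.symm)

end DominationNumber

section CoprimeProducts

variable {H K : Type*} [Group H] [Group K] [Finite H] [Finite K]

theorem dominationNumber_prod_of_isCyclic_left [IsCyclic H]
    (hcop : (Nat.card H).Coprime (Nat.card K)) : γ(H × K) = γ(K) := by
  apply le_antisymm
  · refine dominationNumber_le_of_forall_exists (fun d => (1, d))
      (fun d => mt fun h => ((mem_cyclicizer_prod_iff hcop).1 h).2)
      fun v hv => ⟨v.2, ?_, fun d h => ?_⟩
    · exact mt (fun h => (mem_cyclicizer_prod_iff hcop).2 ⟨mem_cyclicizer_of_isCyclic v.1, h⟩) hv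
    · exact (cyclicallyRelated_prod_iff hcop).2 ⟨.of_isCyclic v.1 1, h⟩
  · refine dominationNumber_le_of_forall_exists Prod.snd
      (fun d => mt fun h => ?_) fun v hv => ⟨(1, v), ?_, fun d h => h.map (.snd H K)⟩
    · exact (mem_cyclicizer_prod_iff hcop).2 ⟨mem_cyclicizer_of_isCyclic d.1, h⟩
    · exact mt (fun h => ((mem_cyclicizer_prod_iff hcop).1 h).2) hv

theorem dominationNumber_prod_le_left (hH : ¬ IsCyclic H)
    (hcop : (Nat.card H).Coprime (Nat.card K)) : γ(H × K) ≤ γ(H) := by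
  refine dominationNumber_le_of_forall_exists (fun d => (d, 1))
    (fun d => mt fun h => ((mem_cyclicizer_prod_iff hcop).1 h).1) fun v _ => ?_
  obtain ⟨x, hx, hxv⟩ := exists_notMem_cyclicizer_forall_imp hH v.1
  exact ⟨x, hx, fun d h => (cyclicallyRelated_prod_iff hcop).2 ⟨hxv d h, .one_right v.2⟩⟩

theorem dominationNumber_prod (hH : ¬ IsCyclic H) (hK : ¬ IsCyclic K)
    (hcop : (Nat.card H).Coprime (Nat.card K)) : γ(H × K) = min γ(H) γ(K) := by
  refine le_antisymm (le_min (dominationNumber_prod_le_left hH hcop)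
    ((dominationNumber_congr MulEquiv.prodComm).trans_le
      (dominationNumber_prod_le_left hK hcop.symm))) ?_
  refine le_dominationNumber_properEnhancedPowerGraph fun D hD => ?_
  by_contra! hlt
  obtain ⟨x, hx, hxD⟩ := exists_forall_related_imp_mem_cyclicizer (G := H) (D := Prod.fst '' D)
    ((Set.encard_image_le _ D).trans_lt (hlt.trans_le (min_le_left _ _)))
  obtain ⟨y, -, hyD⟩ := exists_forall_related_imp_mem_cyclicizer (G := K) (D := Prod.snd '' D)
    ((Set.encard_image_le _ D).trans_lt (hlt.trans_le (min_le_right _ _)))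
  obtain ⟨d, hd, hvd⟩ := hD.exists_related (x, y)
    (mt (fun h => ((mem_cyclicizer_prod_iff hcop).1 h).1) hx)
  obtain ⟨hxd, hyd⟩ := (cyclicallyRelated_prod_iff hcop).1 hvd
  exact hD.notMem_cyclicizer d hd ((mem_cyclicizer_prod_iff hcop).2
    ⟨hxD _ (Set.mem_image_of_mem _ hd) hxd, hyD _ (Set.mem_image_of_mem _ hd) hyd⟩)

variable {ι : Type*} [Finite ι] {P : ι → Type*} [∀ i, Group (P i)] [∀ i, Finite (P i)]

theorem dominationNumber_pi_le
    (hcop : Pairwise (Function.onFun Nat.Coprime fun i => Nat.card (P i)))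
    {i : ι} (hi : ¬ IsCyclic (P i)) : γ(∀ i, P i) ≤ γ(P i) := by
  classical
  refine dominationNumber_le_of_forall_exists (Pi.mulSingle i) (fun d => mt fun h => ?_)
    fun v _ => ?_
  · simpa using (mem_cyclicizer_pi_iff hcop).1 h i
  · obtain ⟨x, hx, hxv⟩ := exists_notMem_cyclicizer_forall_imp hi (v i)
    refine ⟨x, hx, fun d h => (cyclicallyRelated_pi_iff hcop).2 fun j => ?_⟩
    obtain rfl | hj := eq_or_ne j i
    · simpa using hxv d h
    · simpa [hj] using CyclicallyRelated.one_right (v j)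

theorem dominationNumber_pi [Nonempty ι]
    (hcop : Pairwise (Function.onFun Nat.Coprime fun i => Nat.card (P i)))
    (hP : ∀ i, ¬ IsCyclic (P i)) : γ(∀ i, P i) = ⨅ i, γ(P i) := by
  refine le_antisymm (le_iInf fun i => dominationNumber_pi_le hcop (hP i))
    (le_dominationNumber_properEnhancedPowerGraph fun D hD => ?_)
  by_contra! hlt
  have image_lt (i : ι) : (Function.eval i '' D).encard < γ(P i) :=
    (Set.encard_image_le _ D).trans_lt (hlt.trans_le (iInf_le _ i))
  choose v hv hvD using fun i => exists_forall_related_imp_mem_cyclicizer (image_lt i)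
  obtain ⟨i⟩ := ‹Nonempty ι›
  obtain ⟨d, hd, hvd⟩ := hD.exists_related v
    (mt (fun h => (mem_cyclicizer_pi_iff hcop).1 h i) (hv i))
  exact hD.notMem_cyclicizer d hd ((mem_cyclicizer_pi_iff hcop).2 fun j =>
    hvD j (d j) (Set.mem_image_of_mem _ hd) ((cyclicallyRelated_pi_iff hcop).1 hvd j))

end CoprimeProducts

section GeneralizedQuaternion

open QuaternionGroup

variable {m : ℕ}

theorem xa_pow_three (i : ZMod (2 * m)) : xa i ^ 3 = xa (i + (m : ZMod (2 * m))) := by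
  have m_add_m : (m : ZMod (2 * m)) + m = 0 := by
    simpa [two_mul] using ZMod.natCast_self (2 * m)
  rw [pow_succ, xa_sq, a_mul_xa, sub_eq_add_neg, neg_eq_of_add_eq_zero_left m_add_m]

variable [NeZero m]

theorem exists_eq_a_of_mem_zpowers_a {i : ZMod (2 * m)} {y : QuaternionGroup m}
    (h : y ∈ Subgroup.zpowers (a i)) : ∃ j, y = a j := by
  obtain ⟨n, rfl⟩ := mem_powers_iff_mem_zpowers.2 h
  induction n with
  | zero => exact ⟨0, pow_zero _⟩
  | succ n ih =>
    obtain ⟨j, hj⟩ := ih ⟨n, zpow_natCast _ n⟩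
    exact ⟨j + i, by simp_all only [pow_succ, a_mul_a]⟩

theorem eq_of_mem_zpowers_xa {i : ZMod (2 * m)} {y : QuaternionGroup m}
    (h : y ∈ Subgroup.zpowers (xa i)) :
    y = a 0 ∨ y = a m ∨ y = xa i ∨ y = xa (i + (m : ZMod (2 * m))) := by
  obtain ⟨n, rfl⟩ := mem_powers_iff_mem_zpowers.2 h
  have pow_mod_four : xa i ^ n = xa i ^ (n % 4) := by rw [← orderOf_xa i, pow_mod_orderOf]
  have mod_four_lt : n % 4 < 4 := Nat.mod_lt n (by norm_num)
  simp only [pow_mod_four]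
  interval_cases n % 4
  · exact .inl (pow_zero _)
  · exact .inr (.inr (.inl (pow_one _)))
  · exact .inr (.inl (xa_sq i))
  · exact .inr (.inr (.inr (xa_pow_three i)))

theorem zmod_cast_eq_zero_iff {i : ZMod (2 * m)} : (i.cast : ZMod m) = 0 ↔ i = 0 ∨ i = m := by
  constructor
  · rw [ZMod.cast_eq_val, ZMod.natCast_eq_zero_iff]
    rintro ⟨q, hq⟩
    have q_lt_two : q < 2 := by
      have := ZMod.val_lt i
      nlinarith [NeZero.pos m]
    rw [← ZMod.natCast_zmod_val i, hq]
    interval_cases q <;> simp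
  · rintro (rfl | rfl)
    · exact ZMod.cast_zero
    · rw [ZMod.cast_natCast (Dvd.intro_left 2 rfl), ZMod.natCast_self]

theorem cyclicallyRelated_a_a (i j : ZMod (2 * m)) : CyclicallyRelated (a i) (a j) := by
  have mem_zpowers_a_one (l : ZMod (2 * m)) : a l ∈ Subgroup.zpowers (a 1) :=
    mem_powers_iff_mem_zpowers.1 ⟨l.val, by simp [a_one_pow]⟩
  exact ⟨a 1, mem_zpowers_a_one i, mem_zpowers_a_one j⟩

theorem cyclicallyRelated_a_xa_iff {i j : ZMod (2 * m)} :
    CyclicallyRelated (a i) (xa j) ↔ i = 0 ∨ i = m := by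
  constructor
  · rintro ⟨l | l, hi, hj⟩
    · obtain ⟨_, ⟨⟩⟩ := exists_eq_a_of_mem_zpowers_a hj
    · simpa [-a_zero] using eq_of_mem_zpowers_xa hi
  · rintro (rfl | rfl)
    · exact .of_mem_zpowers (one_mem _)
    · exact .of_mem_zpowers ⟨2, xa_sq j⟩

theorem cyclicallyRelated_xa_xa_iff {i j : ZMod (2 * m)} :
    CyclicallyRelated (xa i) (xa j) ↔ (i.cast : ZMod m) = j.cast := by
  have m_dvd : m ∣ 2 * m := Dvd.intro_left 2 rfl
  constructor
  · rintro ⟨l | l, hi, hj⟩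
    · obtain ⟨_, ⟨⟩⟩ := exists_eq_a_of_mem_zpowers_a hi
    · have cast_eq {n : ZMod (2 * m)} (hn : xa n ∈ Subgroup.zpowers (xa l)) :
          (n.cast : ZMod m) = l.cast := by
        obtain ⟨⟨⟩⟩ | ⟨⟨⟩⟩ | ⟨⟨⟩⟩ | ⟨⟨⟩⟩ := eq_of_mem_zpowers_xa hn
        · rfl
        · rw [ZMod.cast_add m_dvd, ZMod.cast_natCast m_dvd, ZMod.natCast_self, add_zero]
      rw [cast_eq hi, cast_eq hj]
  · rw [← sub_eq_zero, ← ZMod.cast_sub m_dvd, zmod_cast_eq_zero_iff, sub_eq_zero,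
      sub_eq_iff_eq_add']
    rintro (rfl | rfl)
    · exact .refl _
    · exact .of_mem_zpowers ⟨3, xa_pow_three j⟩

theorem not_cyclicallyRelated_a_one_xa (hm : 2 ≤ m) (j : ZMod (2 * m)) :
    ¬ CyclicallyRelated (a 1) (xa j) := by
  have : Fact (1 < m) := ⟨hm⟩
  rw [cyclicallyRelated_a_xa_iff, ← zmod_cast_eq_zero_iff,
    ZMod.cast_one (Dvd.intro_left 2 rfl)]
  exact one_ne_zero

/-- Generators of the maximal cyclic subgroups of the quaternion group: `⟨a 1⟩` of order `2 * m`,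
and the subgroups `⟨xa i⟩ = ⟨xa (i + m)⟩` of order `4`. -/
def maxCyclicGenerator (m : ℕ) : Option (ZMod m) → QuaternionGroup m
  | none => a 1
  | some j => xa j.cast

theorem maxCyclicGenerator_notMem_cyclicizer (hm : 2 ≤ m) (i : Option (ZMod m)) :
    maxCyclicGenerator m i ∉ cyclicizer (QuaternionGroup m) := by
  cases i with
  | none => exact fun h => not_cyclicallyRelated_a_one_xa hm 0 (h (xa 0))
  | some j => exact fun h => not_cyclicallyRelated_a_one_xa hm _ (h (a 1)).symm

theorem existsUnique_cyclicallyRelated_maxCyclicGenerator (hm : 2 ≤ m) {d : QuaternionGroup m}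
    (hd : d ∉ cyclicizer (QuaternionGroup m)) :
    ∃! i, CyclicallyRelated d (maxCyclicGenerator m i) := by
  cases d with
  | a i =>
    refine ⟨none, cyclicallyRelated_a_a i 1, ?_⟩
    rintro (_ | j) h
    · rfl
    · refine absurd ?_ hd
      rintro (l | l)
      · exact cyclicallyRelated_a_a i l
      · exact cyclicallyRelated_a_xa_iff.2 (cyclicallyRelated_a_xa_iff.1 h)
  | xa i =>
    have cast_cast (j : ZMod m) : ((j.cast : ZMod (2 * m)).cast : ZMod m) = j := by
      rw [ZMod.cast_eq_val j, ZMod.cast_natCast (Dvd.intro_left 2 rfl), ZMod.natCast_zmod_val]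
    refine ⟨some i.cast, cyclicallyRelated_xa_xa_iff.2 (cast_cast _).symm, ?_⟩
    rintro (_ | j) h
    · exact absurd h.symm (not_cyclicallyRelated_a_one_xa hm i)
    · rw [cyclicallyRelated_xa_xa_iff.1 h, cast_cast]

theorem dominationNumber_quaternionGroup (hm : 2 ≤ m) :
    γ(QuaternionGroup m) = ((m + 1 : ℕ) : ℕ∞) := by
  rw [dominationNumber_eq_card_of_existsUnique _ (maxCyclicGenerator_notMem_cyclicizer hm)
    fun d hd => existsUnique_cyclicallyRelated_maxCyclicGenerator hm hd]
  simp

theorem not_isCyclic_quaternionGroup (hm : 2 ≤ m) : ¬ IsCyclic (QuaternionGroup m) :=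
  fun _ => maxCyclicGenerator_notMem_cyclicizer hm none (mem_cyclicizer_of_isCyclic _)

end GeneralizedQuaternion

open scoped commutatorElement

section FrattiniSubgroup

variable {G : Type*} [Group G]

theorem mem_frattini_iff {x : G} : x ∈ frattini G ↔ ∀ M : Subgroup G, IsCoatom M → x ∈ M := by
  simp only [frattini, Order.radical, Subgroup.mem_iInf, Set.mem_ofPred_eq]

variable [Finite G]

theorem exists_isCoatom_mem_of_not_isCyclic (hG : ¬ IsCyclic G) (x : G) :
    ∃ M : Subgroup G, IsCoatom M ∧ x ∈ M := by
  have zpowers_ne_top : Subgroup.zpowers x ≠ ⊤ := fun h =>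
    hG (isCyclic_iff_exists_zpowers_eq_top.2 ⟨x, h⟩)
  obtain ⟨M, hM, hxM⟩ := (eq_top_or_exists_le_coatom _).resolve_left zpowers_ne_top
  exact ⟨M, hM, Subgroup.zpowers_le.1 hxM⟩

theorem isCyclic_of_isCoatom_frattini (h : IsCoatom (frattini G)) : IsCyclic G := by
  by_contra hG
  refine h.1 (eq_top_iff.2 fun x _ => ?_)
  obtain ⟨M, hM, hxM⟩ := exists_isCoatom_mem_of_not_isCyclic hG x
  exact (h.le_iff_eq hM.1).1 (frattini_le_coatom hM) ▸ hxM

theorem frattini_le_center (hG : ¬ IsCyclic G)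
    (hcomm : ∀ M : Subgroup G, IsCoatom M → IsMulCommutative M) :
    frattini G ≤ Subgroup.center G := by
  refine fun c hc => Subgroup.mem_center_iff.2 fun g => ?_
  obtain ⟨M, hM, hgM⟩ := exists_isCoatom_mem_of_not_isCyclic hG g
  have := hcomm M hM
  exact congr_arg Subtype.val (mul_comm' (⟨g, hgM⟩ : M) ⟨c, mem_frattini_iff.1 hc M hM⟩)

variable {p : ℕ} [Fact p.Prime]

theorem index_eq_of_isCoatom (hG : IsPGroup p G) {M : Subgroup G} (hM : IsCoatom M) :
    M.index = p := by
  have hp : p.Prime := Fact.out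
  obtain ⟨n, hn⟩ := IsPGroup.iff_card.1 (hG.to_subgroup M)
  obtain ⟨N, hN⟩ := IsPGroup.iff_card.1 hG
  have n_lt_N : n < N := by
    rw [← Nat.pow_lt_pow_iff_right hp.one_lt, ← hn, ← hN]
    exact lt_of_le_of_ne M.card_le_card_group fun h => hM.1 (M.eq_top_of_card_eq h)
  obtain ⟨K, hK, hMK⟩ := Sylow.exists_subgroup_card_pow_succ (hN ▸ pow_dvd_pow p n_lt_N) hn
  have K_eq_top : K = ⊤ := hM.2 K <| lt_of_le_of_ne hMK fun h => by
    rw [h, hK] at hn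
    exact n.succ_ne_self (Nat.pow_right_injective hp.two_le hn)
  have card_mul_index := M.card_mul_index
  rw [← Subgroup.card_top (G := G), ← K_eq_top, hn, hK, pow_succ] at card_mul_index
  exact Nat.eq_of_mul_eq_mul_left (pow_pos hp.pos n) card_mul_index

theorem normal_of_isCoatom (hG : IsPGroup p G) {M : Subgroup G} (hM : IsCoatom M) : M.Normal :=
  have := hG.isNilpotent
  Subgroup.NormalizerCondition.normal_of_coatom M Group.normalizerCondition_of_isNilpotent hM

theorem pow_mem_frattini (hG : IsPGroup p G) (x : G) : x ^ p ∈ frattini G := by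
  refine mem_frattini_iff.2 fun M hM => ?_
  have := normal_of_isCoatom hG hM
  exact index_eq_of_isCoatom hG hM ▸ M.pow_index_mem x

theorem commutator_mem_frattini (hG : IsPGroup p G) (a b : G) : ⁅a, b⁆ ∈ frattini G := by
  refine mem_frattini_iff.2 fun M hM => ?_
  have := normal_of_isCoatom hG hM
  have : IsCyclic (G ⧸ M) := isCyclic_of_prime_card (index_eq_of_isCoatom hG hM)
  rw [← QuotientGroup.eq_one_iff, ← QuotientGroup.mk'_apply, map_commutatorElement,
    commutatorElement_eq_one_iff_mul_comm]
  exact mul_comm' _ _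

end FrattiniSubgroup

section CentralCommutator

variable {G : Type*} [Group G] {a b : G}

theorem pow_mul_of_commutator_mem_center (h : ⁅b, a⁆ ∈ Subgroup.center G) (n : ℕ) :
    b ^ n * a = ⁅b, a⁆ ^ n * (a * b ^ n) := by
  induction n with
  | zero => simp
  | succ n ih =>
    have mul_central_pow : b * ⁅b, a⁆ ^ n = ⁅b, a⁆ ^ n * b :=
      Subgroup.mem_center_iff.1 (pow_mem h n) b
    have mul_eq : b * a = ⁅b, a⁆ * (a * b) := by group
    calc b ^ (n + 1) * a = b * (b ^ n * a) := by rw [pow_succ', mul_assoc]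
      _ = (b * ⁅b, a⁆ ^ n) * (a * b ^ n) := by rw [ih, mul_assoc]
      _ = ⁅b, a⁆ ^ n * (b * a) * b ^ n := by rw [mul_central_pow]; simp only [mul_assoc]
      _ = ⁅b, a⁆ ^ (n + 1) * (a * b ^ (n + 1)) := by
        rw [mul_eq, pow_succ, pow_succ' b]; simp only [mul_assoc]

theorem mul_pow_of_commutator_mem_center (h : ⁅b, a⁆ ∈ Subgroup.center G) (n : ℕ) :
    (a * b) ^ n = ⁅b, a⁆ ^ n.choose 2 * (a ^ n * b ^ n) := by
  induction n with
  | zero => simp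
  | succ n ih =>
    have mul_central_pow : a ^ n * ⁅b, a⁆ ^ n = ⁅b, a⁆ ^ n * a ^ n :=
      Subgroup.mem_center_iff.1 (pow_mem h n) (a ^ n)
    calc (a * b) ^ (n + 1) = ⁅b, a⁆ ^ n.choose 2 * (a ^ n * (b ^ n * a) * b) := by
          rw [pow_succ, ih]; simp only [mul_assoc]
      _ = ⁅b, a⁆ ^ n.choose 2 * ((a ^ n * ⁅b, a⁆ ^ n) * (a * b ^ n) * b) := by
          rw [pow_mul_of_commutator_mem_center h]; simp only [mul_assoc]
      _ = ⁅b, a⁆ ^ (n.choose 2 + n) * (a ^ (n + 1) * b ^ (n + 1)) := by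
          rw [mul_central_pow, pow_add, pow_succ a, pow_succ b]; simp only [mul_assoc]
      _ = ⁅b, a⁆ ^ (n + 1).choose 2 * (a ^ (n + 1) * b ^ (n + 1)) := by
          rw [Nat.choose_succ_succ' n 1, Nat.choose_one_right, add_comm]

theorem mul_pow_prime_of_mem_center {p : ℕ} (hp : p.Prime) (hp2 : p ≠ 2)
    (hcomm : ⁅b, a⁆ ∈ Subgroup.center G) (hpow : b ^ p ∈ Subgroup.center G) :
    (a * b) ^ p = a ^ p * b ^ p := by
  have commutator_pow : ⁅b, a⁆ ^ p = 1 := by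
    have h := pow_mul_of_commutator_mem_center hcomm p
    rw [← Subgroup.mem_center_iff.1 hpow a] at h
    exact right_eq_mul.1 h
  obtain ⟨q, hq⟩ : p ∣ p.choose 2 :=
    hp.dvd_choose_self two_ne_zero (lt_of_le_of_ne hp.two_le hp2.symm)
  rw [mul_pow_of_commutator_mem_center hcomm, hq, pow_mul, commutator_pow, one_pow, one_mul]

end CentralCommutator

section UniqueSubgroupOfPrimeOrder

variable {G : Type*} [Group G]

theorem eq_of_natCard_eq_of_isCyclic [Finite G] [IsCyclic G] {H K : Subgroup G}
    (h : Nat.card H = Nat.card K) : H = K := by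
  let := IsCyclic.commGroup (α := G)
  have eq_ker (L : Subgroup G) : L = (powMonoidHom (Nat.card L) : G →* G).ker := by
    refine Subgroup.eq_of_le_of_card_ge (fun x hx => ?_) ?_
    · exact orderOf_dvd_iff_pow_eq_one.1 (L.orderOf_dvd_natCard hx)
    · rw [IsCyclic.card_powMonoidHom_ker]
      exact Nat.gcd_le_right _ Nat.card_pos
  rw [eq_ker H, eq_ker K, h]

theorem subsingleton_subgroups_card_eq_of_injective {H : Type*} [Group H] {f : H →* G}
    (hf : Function.Injective f) (n : ℕ) [Subsingleton {K : Subgroup G // Nat.card K = n}] :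
    Subsingleton {K : Subgroup H // Nat.card K = n} := by
  refine ⟨fun K L => Subtype.ext (Subgroup.map_injective hf ?_)⟩
  have card_map (K : {K : Subgroup H // Nat.card K = n}) : Nat.card (K.1.map f) = n :=
    (Subgroup.card_map_of_injective hf).trans K.2
  exact congr_arg Subtype.val (Subsingleton.elim
    (⟨K.1.map f, card_map K⟩ : {K : Subgroup G // Nat.card K = n}) ⟨L.1.map f, card_map L⟩)

variable {p : ℕ} [Fact p.Prime]

theorem mem_of_pow_eq_one_of_subsingleton [Subsingleton {K : Subgroup G // Nat.card K = p}]
    {K : Subgroup G} (hK : Nat.card K = p) {x : G} (hx : x ^ p = 1) : x ∈ K := by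
  obtain rfl | hx1 := eq_or_ne x 1
  · exact one_mem K
  · have card_zpowers : Nat.card (Subgroup.zpowers x) = p :=
      (Nat.card_zpowers x).trans (orderOf_eq_prime hx hx1)
    have zpowers_eq : Subgroup.zpowers x = K := congr_arg Subtype.val (Subsingleton.elim
      (⟨_, card_zpowers⟩ : {K : Subgroup G // Nat.card K = p}) ⟨K, hK⟩)
    exact zpowers_eq ▸ Subgroup.mem_zpowers x

theorem isCyclic_of_forall_isCoatom_isMulCommutative [Finite G] (hp2 : p ≠ 2) (hG : IsPGroup p G)
    [Subsingleton {K : Subgroup G // Nat.card K = p}]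
    (hcomm : ∀ M : Subgroup G, IsCoatom M → IsMulCommutative M) : IsCyclic G := by
  by_contra hcyc
  have frattini_le := frattini_le_center hcyc hcomm
  let powHom : G →* G := MonoidHom.mk' (· ^ p) fun a b => mul_pow_prime_of_mem_center Fact.out hp2
    (frattini_le (commutator_mem_frattini hG b a)) (frattini_le (pow_mem_frattini hG b))
  have range_le_frattini : powHom.range ≤ frattini G := by
    rintro _ ⟨x, rfl⟩
    exact pow_mem_frattini hG x
  obtain ⟨M, hM, -⟩ := exists_isCoatom_mem_of_not_isCyclic hcyc 1
  have card_ker_le : Nat.card powHom.ker ≤ p := by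
    obtain ⟨K, hK⟩ := Sylow.exists_subgroup_card_pow_prime p (n := 1)
      (by simpa using index_eq_of_isCoatom hG hM ▸ M.index_dvd_card)
    rw [pow_one] at hK
    exact hK ▸ Subgroup.card_le_of_le fun x hx => mem_of_pow_eq_one_of_subsingleton hK hx
  have frattini_index_le : (frattini G).index ≤ M.index := calc
    (frattini G).index ≤ powHom.range.index :=
      Subgroup.index_antitone range_le_frattini
    _ = Nat.card powHom.ker := Subgroup.index_range
    _ ≤ p := card_ker_le
    _ = M.index := (index_eq_of_isCoatom hG hM).symm
  have card_le : Nat.card M ≤ Nat.card (frattini G) := by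
    refine Nat.le_of_mul_le_mul_right ?_ (Nat.pos_of_ne_zero M.index_ne_zero_of_finite)
    rw [M.card_mul_index, ← (frattini G).card_mul_index]
    exact Nat.mul_le_mul_left _ frattini_index_le
  have frattini_eq : frattini G = M := Subgroup.eq_of_le_of_card_ge (frattini_le_coatom hM) card_le
  exact hcyc (isCyclic_of_isCoatom_frattini (frattini_eq ▸ hM))

theorem isCyclic_of_subsingleton_subgroups_card_eq [Finite G] (hp2 : p ≠ 2) (hG : IsPGroup p G)
    [Subsingleton {K : Subgroup G // Nat.card K = p}] : IsCyclic G := by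
  induction hn : Nat.card G using Nat.strong_induction_on generalizing G with
  | _ n ih =>
    refine isCyclic_of_forall_isCoatom_isMulCommutative hp2 hG fun M hM => ?_
    have := subsingleton_subgroups_card_eq_of_injective M.subtype_injective p
    have card_lt : Nat.card M < n := hn ▸ lt_of_le_of_ne M.card_le_card_group
      fun h => hM.1 (M.eq_top_of_card_eq h)
    have := ih _ card_lt (hG.to_subgroup M) rfl
    infer_instance

end UniqueSubgroupOfPrimeOrder

section PrimeOrderSubgroups

variable {G : Type*} [Group G] {p : ℕ} [Fact p.Prime]

theorem exists_zpowers_eq_of_natCard_eq_prime {K : Subgroup G} (hK : Nat.card K = p) :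
    ∃ g, Subgroup.zpowers g = K :=
  K.isCyclic_iff_exists_zpowers_eq_top.1 (isCyclic_of_prime_card hK)

variable [Finite G]

theorem eq_of_natCard_eq_of_le_zpowers {w : G} {H K : Subgroup G} (hH : H ≤ Subgroup.zpowers w)
    (hK : K ≤ Subgroup.zpowers w) (h : Nat.card H = Nat.card K) : H = K := by
  have subgroupOf_eq : H.subgroupOf (Subgroup.zpowers w) = K.subgroupOf (Subgroup.zpowers w) := by
    apply eq_of_natCard_eq_of_isCyclic
    rw [Nat.card_congr (Subgroup.subgroupOfEquivOfLe hH).toEquiv,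
      Nat.card_congr (Subgroup.subgroupOfEquivOfLe hK).toEquiv, h]
  rwa [Subgroup.subgroupOf_inj, inf_eq_left.2 hH, inf_eq_left.2 hK] at subgroupOf_eq

theorem exists_le_zpowers_natCard_eq (hG : IsPGroup p G) {d : G} (hd : d ≠ 1) :
    ∃ K ≤ Subgroup.zpowers d, Nat.card K = p := by
  have hdvd : p ∣ orderOf d := hG.dvd_orderOf hd
  refine ⟨Subgroup.zpowers (d ^ (orderOf d / p)), ?_, ?_⟩
  · exact Subgroup.zpowers_le.2 (Subgroup.npow_mem_zpowers d _)
  · rw [Nat.card_zpowers, orderOf_pow_orderOf_div (orderOf_pos d).ne' hdvd]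

theorem cyclicallyRelated_iff_mem_zpowers_of_orderOf_eq_prime (hG : IsPGroup p G) {d g : G}
    (hd : d ≠ 1) (hg : orderOf g = p) : CyclicallyRelated d g ↔ g ∈ Subgroup.zpowers d := by
  refine ⟨fun ⟨w, hdw, hgw⟩ => ?_, fun h => (CyclicallyRelated.of_mem_zpowers h).symm⟩
  obtain ⟨K, hKd, hK⟩ := exists_le_zpowers_natCard_eq hG hd
  have zpowers_eq : Subgroup.zpowers g = K := eq_of_natCard_eq_of_le_zpowers (w := w)
    (Subgroup.zpowers_le.2 hgw) (hKd.trans (Subgroup.zpowers_le.2 hdw))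
    (by rw [Nat.card_zpowers, hg, hK])
  exact hKd (zpowers_eq ▸ Subgroup.mem_zpowers g)

theorem dominationNumber_eq_card_subgroups_of_isPGroup (hG : IsPGroup p G)
    [Nontrivial {K : Subgroup G // Nat.card K = p}] :
    γ(G) = Nat.card {K : Subgroup G // Nat.card K = p} := by
  choose g hg using fun K : {K : Subgroup G // Nat.card K = p} =>
    exists_zpowers_eq_of_natCard_eq_prime K.2
  have orderOf_g (K) : orderOf (g K) = p := by rw [← Nat.card_zpowers, hg, K.2]
  have related_iff (d : G) (hd : d ≠ 1) (K) :
      CyclicallyRelated d (g K) ↔ K.1 ≤ Subgroup.zpowers d := by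
    rw [cyclicallyRelated_iff_mem_zpowers_of_orderOf_eq_prime hG hd (orderOf_g K), ← hg K,
      Subgroup.zpowers_le]
  rw [← ENat.card_eq_coe_natCard]
  refine dominationNumber_eq_card_of_existsUnique g (fun K hK => ?_) fun d hd => ?_
  · obtain ⟨L, hLK⟩ := exists_ne K
    have g_ne_one : g K ≠ 1 := fun h =>
      (Fact.out : p.Prime).one_lt.ne' (by rw [← orderOf_g K, h, orderOf_one])
    have L_le : L.1 ≤ K.1 := hg K ▸ (related_iff (g K) g_ne_one L).1 (hK (g L))
    exact hLK (Subtype.ext (Subgroup.eq_of_le_of_card_ge L_le (by rw [K.2, L.2])))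
  · have d_ne_one : d ≠ 1 := by
      rintro rfl
      exact hd fun u => (CyclicallyRelated.one_right u).symm
    obtain ⟨K, hKd, hK⟩ := exists_le_zpowers_natCard_eq hG d_ne_one
    exact ⟨⟨K, hK⟩, (related_iff d d_ne_one _).2 hKd, fun L hL => Subtype.ext
      (eq_of_natCard_eq_of_le_zpowers ((related_iff d d_ne_one L).1 hL) hKd (by rw [L.2, hK]))⟩

theorem dominationNumber_eq_card_subgroups_of_not_isCyclic (hp2 : p ≠ 2) (hG : IsPGroup p G)
    (hcyc : ¬ IsCyclic G) : γ(G) = Nat.card {K : Subgroup G // Nat.card K = p} := by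
  have : Nontrivial {K : Subgroup G // Nat.card K = p} := by
    refine not_subsingleton_iff_nontrivial.1 fun _ => hcyc ?_
    exact isCyclic_of_subsingleton_subgroups_card_eq hp2 hG
  exact dominationNumber_eq_card_subgroups_of_isPGroup hG

end PrimeOrderSubgroups

section SylowDecomposition

variable {G : Type*} [Group G] [Finite G]

theorem pairwise_coprime_natCard_sylow (P : ∀ q : (Nat.card G).primeFactors, Sylow q G) :
    Pairwise (Function.onFun Nat.Coprime fun q => Nat.card (P q)) := fun q r hqr => by
  have := Fact.mk (Nat.prime_of_mem_primeFactors q.2)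
  have := Fact.mk (Nat.prime_of_mem_primeFactors r.2)
  exact IsPGroup.coprime_card_of_ne q r (Subtype.coe_ne_coe.2 hqr) _ _ (P q).isPGroup'
    (P r).isPGroup'

variable [Group.IsNilpotent G]

theorem subsingleton_sylow (p : ℕ) [Fact p.Prime] : Subsingleton (Sylow p G) := by
  have normal := (Group.isNilpotent_of_finite_tfae (G := G).out 0 3 rfl rfl).1 ‹_›
  exact (Sylow.unique_of_normal default (normal p ‹_› default)).instSubsingleton

theorem nonempty_mulEquiv_pi_sylow (P : ∀ q : (Nat.card G).primeFactors, Sylow q G) :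
    Nonempty (G ≃* ∀ q, P q) := by
  obtain ⟨e⟩ := (Group.isNilpotent_of_finite_tfae (G := G).out 0 4 rfl rfl).1 ‹_›
  refine ⟨e.symm.trans (MulEquiv.piCongrRight fun q => ?_)⟩
  have := Fact.mk (Nat.prime_of_mem_primeFactors q.2)
  have := subsingleton_sylow (G := G) q
  let : Unique (Sylow q G) := uniqueOfSubsingleton (P q)
  exact MulEquiv.piUnique _

theorem minNumPrimeOrderSubgroups_eq_iInf (P : ∀ q : (Nat.card G).primeFactors, Sylow q G) :
    minNumPrimeOrderSubgroups G = ⨅ q, Nat.card {K : Subgroup (P q) // Nat.card K = q} := by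
  refine congrArg sInf (Set.ext fun r => ⟨?_, ?_⟩)
  · rintro ⟨p, hp, hdvd, Q, rfl⟩
    have := Fact.mk hp
    have := subsingleton_sylow (G := G) p
    let q : (Nat.card G).primeFactors := ⟨p, hp.mem_primeFactors hdvd Nat.card_pos.ne'⟩
    exact ⟨q, by rw [Subsingleton.elim Q (P q)]⟩
  · rintro ⟨q, rfl⟩
    exact ⟨q, Nat.prime_of_mem_primeFactors q.2, Nat.dvd_of_mem_primeFactors q.2, P q, rfl⟩

end SylowDecomposition

theorem IsNilpotentWithoutCyclicOrQuaternionSylow.dominationNumber_eq {G : Type*} [Group G]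
    (hG : IsNilpotentWithoutCyclicOrQuaternionSylow G) (hodd : (Nat.card G).Coprime 2) :
    γ(G) = minNumPrimeOrderSubgroups G := by
  have := hG.finite
  have := hG.nontrivial
  have := hG.nilpotent
  let P (q : (Nat.card G).primeFactors) : Sylow q G := default
  have sylow_not_isCyclic (q) : ¬ IsCyclic (P q) := (hG.sylow q
    (Nat.prime_of_mem_primeFactors q.2) (Nat.dvd_of_mem_primeFactors q.2) (P q)).1
  have dominationNumber_sylow (q) :
      γ(P q) = Nat.card {K : Subgroup (P q) // Nat.card K = q} := by
    have := Fact.mk (Nat.prime_of_mem_primeFactors q.2)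
    have q_ne_two : (q : ℕ) ≠ 2 := fun h =>
      Nat.prime_two.coprime_iff_not_dvd.1 hodd.symm (h ▸ Nat.dvd_of_mem_primeFactors q.2)
    exact dominationNumber_eq_card_subgroups_of_not_isCyclic q_ne_two (P q).isPGroup'
      (sylow_not_isCyclic q)
  have : Nonempty (Nat.card G).primeFactors :=
    (Nat.nonempty_primeFactors.2 Finite.one_lt_card).to_subtype
  obtain ⟨e⟩ := nonempty_mulEquiv_pi_sylow P
  rw [minNumPrimeOrderSubgroups_eq_iInf P, ENat.natCast_iInf]
  calc γ(G) = γ(∀ q, P q) := dominationNumber_congr e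
    _ = ⨅ q, γ(P q) := dominationNumber_pi (pairwise_coprime_natCard_sylow P) sylow_not_isCyclic
    _ = ⨅ q, (Nat.card {K : Subgroup (P q) // Nat.card K = q} : ℕ∞) :=
      iInf_congr dominationNumber_sylow

section Structure

theorem coprime_natCard_pi {ι : Type*} [Finite ι] {P : ι → Type*} {n : ℕ}
    (h : ∀ i, (Nat.card (P i)).Coprime n) : (Nat.card (∀ i, P i)).Coprime n := by
  cases nonempty_fintype ι
  rw [Nat.card_pi]
  exact Nat.Coprime.prod_left fun i _ => h i

/-- `Equiv.piEquivPiSubtypeProd` as a group isomorphism. -/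
def piMulEquivPiSubtypeProd {ι : Type*} (s : ι → Prop) [DecidablePred s] (P : ι → Type*)
    [∀ i, Group (P i)] : (∀ i, P i) ≃* (∀ i : {i // s i}, P i) × (∀ i : {i // ¬ s i}, P i) :=
  { Equiv.piEquivPiSubtypeProd s P with map_mul' := fun _ _ => rfl }

theorem coprime_natCard_of_isPGroup {p q : ℕ} [Fact p.Prime] (hq : q.Prime) (hpq : p ≠ q)
    {G : Type*} [Group G] [Finite G] (hG : IsPGroup p G) : (Nat.card G).Coprime q := by
  obtain ⟨n, hn⟩ := hG.exists_card_eq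
  exact hn ▸ Nat.Coprime.pow_left n ((Nat.coprime_primes Fact.out hq).2 hpq)

theorem two_dvd_natCard_genQuaternion (k : ℕ) : 2 ∣ Nat.card (GenQuaternion k) := by
  rw [Nat.card_eq_fintype_card, QuaternionGroup.card]
  exact Dvd.dvd.mul_right (by norm_num) _

theorem not_isGenQuaternion_of_isPGroup {p : ℕ} [Fact p.Prime] (hp2 : p ≠ 2) {G : Type*} [Group G]
    [Finite G] (hG : IsPGroup p G) : ¬ IsGenQuaternion G := by
  rintro ⟨k, -, ⟨e⟩⟩
  have coprime_two := coprime_natCard_of_isPGroup Nat.prime_two hp2 hG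
  rw [Nat.card_congr e.toEquiv] at coprime_two
  exact Nat.prime_two.coprime_iff_not_dvd.1 coprime_two.symm (two_dvd_natCard_genQuaternion k)

theorem not_isCyclic_sylow_of_injective {p : ℕ} [Fact p.Prime] {G H : Type*} [Group G] [Group H]
    [Finite G] {f : H →* G} (hf : Function.Injective f) (hH : IsPGroup p H) (hcyc : ¬ IsCyclic H)
    (Q : Sylow p G) : ¬ IsCyclic Q := fun _ => by
  obtain ⟨R, hR⟩ := (hH.of_equiv (MonoidHom.ofInjective hf)).exists_le_sylow
  have : IsCyclic R := isCyclic_of_surjective (Q.equiv R) (Q.equiv R).surjective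
  have : IsCyclic f.range := isCyclic_of_injective _ (Subgroup.inclusion_injective hR)
  exact hcyc (isCyclic_of_injective f.rangeRestrict (f.rangeRestrict_injective_iff.2 hf))

theorem isNilpotentWithoutCyclicOrQuaternionSylow_of_mulEquiv_pi {H : Type*} [Group H]
    [Nontrivial H] {ι : Type*} [Finite ι] {P : ι → Type*} [∀ i, Group (P i)] [∀ i, Finite (P i)]
    {p : ι → ℕ} [∀ i, Fact (p i).Prime] (hp2 : ∀ i, p i ≠ 2) (hP : ∀ i, IsPGroup (p i) (P i))
    (hcyc : ∀ i, ¬ IsCyclic (P i)) (e : H ≃* ∀ i, P i) :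
    IsNilpotentWithoutCyclicOrQuaternionSylow H := by
  classical
  have := Finite.of_equiv _ e.symm.toEquiv
  have := fun i => (hP i).isNilpotent
  refine ⟨‹_›, ‹_›, Group.nilpotent_of_mulEquiv e.symm, fun q hq hdvd Q => ?_⟩
  have := Fact.mk hq
  obtain ⟨i, rfl⟩ : ∃ i, p i = q := by
    by_contra! hne
    refine hq.coprime_iff_not_dvd.1 (Nat.Coprime.symm ?_) hdvd
    rw [Nat.card_congr e.toEquiv]
    exact coprime_natCard_pi fun i => coprime_natCard_of_isPGroup hq (hne i) (hP i)
  let f : P i →* H := e.symm.toMonoidHom.comp (MonoidHom.mulSingle P i)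
  have f_injective : Function.Injective f := e.symm.injective.comp (Pi.mulSingle_injective i)
  exact ⟨not_isCyclic_sylow_of_injective f_injective (hP i) (hcyc i) Q,
    not_isGenQuaternion_of_isPGroup (hp2 i) Q.isPGroup'⟩

theorem exists_subgroup_mulEquiv_of_mulEquiv_prod {G A B : Type*} [Group G] [Group A] [Group B]
    (e : G ≃* A × B) : ∃ H : Subgroup G, Nonempty (A ≃* H) := by
  let f : A →* G := e.symm.toMonoidHom.comp (MonoidHom.inl A B)
  have f_injective : Function.Injective f :=
    e.symm.injective.comp fun _ _ h => (Prod.ext_iff.1 h).1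
  exact ⟨f.range, ⟨MonoidHom.ofInjective f_injective⟩⟩

variable {G : Type*} [Group G] [Finite G] [Group.IsNilpotent G]

theorem nonempty_mulEquiv_pi_sylow_prod {p : ℕ} [Fact p.Prime] (hp : p ∣ Nat.card G)
    (S : ∀ q : (Nat.card G).primeFactors, Sylow q G) (P : Sylow p G) :
    Nonempty (G ≃* (∀ q : {q : (Nat.card G).primeFactors // q.1 ≠ p}, S q) × P) := by
  classical
  have := subsingleton_sylow (G := G) p
  let p' : (Nat.card G).primeFactors :=
    ⟨p, (Fact.out : p.Prime).mem_primeFactors hp Nat.card_pos.ne'⟩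
  obtain ⟨e⟩ := nonempty_mulEquiv_pi_sylow S
  let : Unique {q : (Nat.card G).primeFactors // ¬ q.1 ≠ p} :=
    ⟨⟨⟨p', not_not.2 rfl⟩⟩, fun q => Subtype.ext (Subtype.ext (not_not.1 q.2))⟩
  have S_eq : S p' = P := Subsingleton.elim _ _
  exact ⟨e.trans ((piMulEquivPiSubtypeProd _ _).trans ((MulEquiv.refl _).prodCongr
    ((MulEquiv.piUnique _).trans (MulEquiv.subgroupCongr (congrArg _ S_eq)))))⟩

theorem exists_mulEquiv_prod_zmod_prod_sylow_two (h2 : 2 ∣ Nat.card G) (P : Sylow 2 G) :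
    ∃ (G₁ : Subgroup G) (n : ℕ),
      (Nontrivial G₁ → IsNilpotentWithoutCyclicOrQuaternionSylow G₁) ∧
      (Nat.card G₁).Coprime n ∧ (Nat.card G₁).Coprime 2 ∧ n.Coprime 2 ∧
      Nonempty (G ≃* G₁ × Multiplicative (ZMod n) × P) := by
  classical
  let S (q : (Nat.card G).primeFactors) : Sylow q G := default
  have S_coprime := pairwise_coprime_natCard_sylow S
  have : ∀ q : (Nat.card G).primeFactors, Fact (q : ℕ).Prime :=
    fun q => ⟨Nat.prime_of_mem_primeFactors q.2⟩
  obtain ⟨e⟩ := nonempty_mulEquiv_pi_sylow_prod h2 S P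
  let noncyclic (q : {q : (Nat.card G).primeFactors // q.1 ≠ 2}) : Prop := ¬ IsCyclic (S q)
  let A := ∀ q : {q // noncyclic q}, S q.1
  let C := ∀ q : {q // ¬ noncyclic q}, S q.1
  let e' : G ≃* A × C × P :=
    (e.trans ((piMulEquivPiSubtypeProd noncyclic _).prodCongr (.refl _))).trans .prodAssoc
  obtain ⟨G₁, ⟨eA⟩⟩ := exists_subgroup_mulEquiv_of_mulEquiv_prod e'
  have isCyclic_factor (q : {q // ¬ noncyclic q}) : IsCyclic (S q.1) := not_not.1 q.2
  have C_isCyclic : IsCyclic C := isCyclic_pi (P := fun q : {q // ¬ noncyclic q} => S q.1)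
    fun q r hqr => S_coprime (Subtype.coe_injective.ne (Subtype.coe_injective.ne hqr))
  have coprime_two (q : {q : (Nat.card G).primeFactors // q.1 ≠ 2}) :
      (Nat.card (S q)).Coprime 2 :=
    coprime_natCard_of_isPGroup Nat.prime_two q.2 (S q).isPGroup'
  refine ⟨G₁, Nat.card C, fun _ => ?_, ?_, ?_, coprime_natCard_pi fun q => coprime_two q.1,
    ⟨e'.trans (eA.prodCongr ((zmodCyclicMulEquiv C_isCyclic).symm.prodCongr (.refl _)))⟩⟩
  · exact isNilpotentWithoutCyclicOrQuaternionSylow_of_mulEquiv_pi (fun q => q.1.2)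
      (fun q => (S q.1).isPGroup') (fun q => q.2) eA.symm
  · rw [← Nat.card_congr eA.toEquiv]
    refine coprime_natCard_pi fun q => (coprime_natCard_pi fun r => ?_).symm
    exact S_coprime (Subtype.coe_injective.ne fun h => r.2 (h ▸ q.2))
  · rw [← Nat.card_congr eA.toEquiv]
    exact coprime_natCard_pi fun q => coprime_two q.1

end Structure

section NilpotentTimesQuaternion

namespace IsNilpotentWithoutCyclicOrQuaternionSylow

variable {H K : Type*} [Group H] [Group K] [Finite K]

theorem not_isCyclic (hH : IsNilpotentWithoutCyclicOrQuaternionSylow H) : ¬ IsCyclic H := by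
  intro
  have := hH.finite
  have := hH.nontrivial
  obtain ⟨p, hp, hdvd⟩ := Nat.exists_prime_and_dvd (Finite.one_lt_card (α := H)).ne'
  exact (hH.sylow p hp hdvd default).1 inferInstance

theorem dominationNumber_prod (hH : IsNilpotentWithoutCyclicOrQuaternionSylow H)
    (hodd : (Nat.card H).Coprime 2) (hcop : (Nat.card H).Coprime (Nat.card K))
    (hK : ¬ IsCyclic K) : γ(H × K) = min (minNumPrimeOrderSubgroups H : ℕ∞) γ(K) := by
  have := hH.finite
  rw [_root_.dominationNumber_prod hH.not_isCyclic hK hcop, hH.dominationNumber_eq hodd]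

end IsNilpotentWithoutCyclicOrQuaternionSylow

theorem coprime_natCard_genQuaternion {n : ℕ} (hn : n.Coprime 2) (k : ℕ) :
    n.Coprime (Nat.card (GenQuaternion k)) := by
  rw [Nat.card_eq_fintype_card, QuaternionGroup.card]
  exact (hn.pow_right 2).mul_right (hn.pow_right _)

theorem two_le_two_pow_sub_two {k : ℕ} (hk : 3 ≤ k) : 2 ≤ 2 ^ (k - 2) :=
  Nat.le_self_pow (by lia) 2

theorem dominationNumber_zmod_prod_genQuaternion {k n : ℕ} (hk : 3 ≤ k) (hn : n.Coprime 2) :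
    γ(Multiplicative (ZMod n) × GenQuaternion k) = ((2 ^ (k - 2) + 1 : ℕ) : ℕ∞) := by
  have : NeZero n := ⟨by rintro rfl; simp at hn⟩
  rw [dominationNumber_prod_of_isCyclic_left
    (coprime_natCard_genQuaternion (by simpa using hn) k),
    dominationNumber_quaternionGroup (two_le_two_pow_sub_two hk)]

end NilpotentTimesQuaternion

theorem mainTheorem5 {G : Type*} [Group G] [Finite G] (hG : Group.IsNilpotent G)
    (k : ℕ) (hk : 3 ≤ k) (P : Sylow 2 G) (hP : Nonempty (P ≃* GenQuaternion k)) :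
    -- `G` is of one of the four forms
    (Nonempty (G ≃* GenQuaternion k) ∨
      (∃ n : ℕ, n.Coprime 2 ∧
        Nonempty (G ≃* Multiplicative (ZMod n) × GenQuaternion k)) ∨
      (∃ G₁ : Subgroup G, IsNilpotentWithoutCyclicOrQuaternionSylow G₁ ∧
        (Nat.card G₁).Coprime 2 ∧ Nonempty (G ≃* G₁ × GenQuaternion k)) ∨
      (∃ (G₁ : Subgroup G) (n : ℕ), IsNilpotentWithoutCyclicOrQuaternionSylow G₁ ∧
        (Nat.card G₁).Coprime n ∧ (Nat.card G₁).Coprime 2 ∧ n.Coprime 2 ∧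
        Nonempty (G ≃* G₁ × Multiplicative (ZMod n) × GenQuaternion k))) ∧
    -- `G = Q_{2^k}`
    (Nonempty (G ≃* GenQuaternion k) →
      dominationNumber (properEnhancedPowerGraph G) = ((2 ^ (k - 2) + 1 : ℕ) : ℕ∞)) ∧
    -- `G = Z_n × Q_{2^k}`
    (∀ n : ℕ, n.Coprime 2 → Nonempty (G ≃* Multiplicative (ZMod n) × GenQuaternion k) →
      dominationNumber (properEnhancedPowerGraph G) = ((2 ^ (k - 2) + 1 : ℕ) : ℕ∞)) ∧
    -- `G = G₁ × Q_{2^k}`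
    (∀ (G₁ : Type*) [Group G₁], IsNilpotentWithoutCyclicOrQuaternionSylow G₁ →
      (Nat.card G₁).Coprime 2 → Nonempty (G ≃* G₁ × GenQuaternion k) →
      dominationNumber (properEnhancedPowerGraph G) =
        ((min (minNumPrimeOrderSubgroups G₁) (2 ^ (k - 2) + 1) : ℕ) : ℕ∞)) ∧
    -- `G = G₁ × Z_n × Q_{2^k}`
    (∀ (G₁ : Type*) [Group G₁] (n : ℕ), IsNilpotentWithoutCyclicOrQuaternionSylow G₁ →
      (Nat.card G₁).Coprime n → (Nat.card G₁).Coprime 2 → n.Coprime 2 →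
      Nonempty (G ≃* G₁ × Multiplicative (ZMod n) × GenQuaternion k) →
      dominationNumber (properEnhancedPowerGraph G) =
        ((min (minNumPrimeOrderSubgroups G₁) (2 ^ (k - 2) + 1) : ℕ) : ℕ∞)) := by
  obtain ⟨eP⟩ := hP
  have hm := two_le_two_pow_sub_two hk
  have not_isCyclic_Q : ¬ IsCyclic (GenQuaternion k) := not_isCyclic_quaternionGroup hm
  refine ⟨?_, ?_, ?_, ?_, ?_⟩
  · have two_dvd : 2 ∣ Nat.card G := (Nat.card_congr eP.toEquiv ▸
      two_dvd_natCard_genQuaternion k).trans (P : Subgroup G).card_subgroup_dvd_card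
    obtain ⟨G₁, n, hG₁, hG₁n, hG₁2, hn2, ⟨e⟩⟩ := exists_mulEquiv_prod_zmod_prod_sylow_two two_dvd P
    have e' := e.trans ((MulEquiv.refl _).prodCongr ((MulEquiv.refl _).prodCongr eP))
    obtain _ | h := subsingleton_or_nontrivial G₁
    · have := uniqueOfSubsingleton (1 : G₁)
      exact .inr (.inl ⟨n, hn2, ⟨e'.trans .uniqueProd⟩⟩)
    · exact .inr (.inr (.inr ⟨G₁, n, hG₁ h, hG₁n, hG₁2, hn2, ⟨e'⟩⟩))
  · exact fun ⟨e⟩ => (dominationNumber_congr e).trans (dominationNumber_quaternionGroup hm)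
  · exact fun n hn ⟨e⟩ =>
      (dominationNumber_congr e).trans (dominationNumber_zmod_prod_genQuaternion hk hn)
  · rintro G₁ _ hG₁ hG₁2 ⟨e⟩
    rw [dominationNumber_congr e, hG₁.dominationNumber_prod hG₁2
      (coprime_natCard_genQuaternion hG₁2 k) not_isCyclic_Q, dominationNumber_quaternionGroup hm,
      Nat.mono_cast.map_min]
  · rintro G₁ _ n hG₁ hG₁n hG₁2 hn ⟨e⟩
    have : NeZero n := ⟨by rintro rfl; simp at hn⟩
    have hcop : (Nat.card G₁).Coprime (Nat.card (Multiplicative (ZMod n) × GenQuaternion k)) := by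
      simpa using hG₁n.mul_right (coprime_natCard_genQuaternion hG₁2 k)
    rw [dominationNumber_congr e, hG₁.dominationNumber_prod hG₁2 hcop
      fun h => not_isCyclic_Q (Group.isCyclic_prod_iff.1 h).2.1,
      dominationNumber_zmod_prod_genQuaternion hk hn, Nat.mono_cast.map_min]
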